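/- Let $\mathbf{C}$ be a category enriched over $\mathbf{Top}$ (each $\hom(X,Y)$ is a topological space and all composition maps $\hom(Y,Z)\times\hom(X,Y)\to\hom(X,Z)$ are continuous) in which every morphism is mono, and let $\mathfrak{G}=(G_X)_{X\in\mathrm{Ob}(\mathbf{C})}$ be a family of groups with $G_X\le\mathrm{Aut}(X)$ for every object $X$. Let $A,S$ be objects with $\hom(A,S)\neq\varnothing$ such that $\hom(A,A)$ and $\hom(A,S)$ are locally compact second countable Hausdorff spaces, and assume that $G_A$, with the topology inherited from $\hom(A,A)$, is a topological group and is closed in $\hom(A,A)$. Let $T(A,S)$, the big embedding Ramsey degree of $A$ in $S$, be the least positive integer $n$ such that for every $k\ge 2$ and every Borel coloring $\chi:\hom(A,S)\to\{0,\dots,k-1\}$ (that is, all sets $\chi^{-1}(i)$ are Borel) there is a $w\in\hom(S,S)$ with $|\chi(w\cdot\hom(A,S))|\le n$; if there is no such $n$, put $T(A,S)=\infty$. Then $T(A,S)\ge|G_A|$, where $\infty$ is regarded as greater than or equal to every cardinality and an integer is never $\ge|G_A|$ for infinite $G_A$. In particular, $T(A,S)=\infty$ whenever $G_A$ is infinite.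 -/

import Mathlib

open CategoryTheory

/-- A category enriched over topological spaces: every hom-set is a topological space and
composition `hom(B, C) × hom(A, B) → hom(A, C)` is (jointly) continuous. -/
class TopEnriched (C : Type*) [Category C] where
  /-- The topology on each hom-set. -/
  homTopology : ∀ A B : C, TopologicalSpace (A ⟶ B)
  /-- Joint continuity of composition. -/
  continuous_comp : ∀ A B D : C,
    Continuous fun p : (B ⟶ D) × (A ⟶ B) => p.2 ≫ p.1

namespace TopEnriched

attribute [instance, reducible] homTopology

section

variable {C : Type*} [Category C] [TopEnriched C]

/-- The topology that a subgroup `G ≤ Aut(A)` inherits from `hom(A, A)`. -/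
abbrev subgroupTopology {A : C} (G : Subgroup (Aut A)) : TopologicalSpace G :=
  TopologicalSpace.induced (fun α : G => (α : Aut A).hom) inferInstance

/-- `G ≤ Aut(A)`, with the topology inherited from `hom(A, A)`, is a topological group. -/
def IsTopologicalSubgroup {A : C} (G : Subgroup (Aut A)) : Prop :=
  @IsTopologicalGroup G (subgroupTopology G) _

/-- `G ≤ Aut(A)` is closed as a subset of `hom(A, A)`. -/
def IsClosedInHom {A : C} (G : Subgroup (Aut A)) : Prop :=
  IsClosed {f : A ⟶ A | ∃ α ∈ G, α.hom = f}

end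

section

variable {C : Type*} [Category C]

/-- The relation `f ∼ g ↔ ∃ α ∈ G_A, f = g · α` on `hom(A, B)`. In diagrammatic order
`g · α` is `α.hom ≫ g`. -/
def orbitSetoid (𝔊 : ∀ X : C, Subgroup (Aut X)) (A B : C) : Setoid (A ⟶ B) where
  r f g := ∃ α ∈ 𝔊 A, f = α.hom ≫ g
  iseqv :=
    { refl := fun f => ⟨1, one_mem _, (Category.id_comp f).symm⟩
      symm := by
        rintro f g ⟨α, hα, rfl⟩
        exact ⟨α⁻¹, inv_mem hα, (α.inv_hom_id_assoc g).symm⟩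
      trans := by
        rintro f g h ⟨α, hα, rfl⟩ ⟨β, hβ, rfl⟩
        exact ⟨β * α, mul_mem hβ hα, (Category.assoc _ _ _).symm⟩ }

/-- The set `hom(A, B) / ∼` of classes `f · G_A`. Over a topologically enriched category it
carries the quotient topology. -/
abbrev SubObj (𝔊 : ∀ X : C, Subgroup (Aut X)) (A B : C) : Type _ :=
  Quotient (orbitSetoid 𝔊 A B)

/-- The action `w · (f · G_A) = (w · f) · G_A` of a morphism `w : B → D` on classes. -/
def SubObj.postcomp {𝔊 : ∀ X : C, Subgroup (Aut X)} {A B D : C} (w : B ⟶ D) :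
    SubObj 𝔊 A B → SubObj 𝔊 A D :=
  Quotient.map (fun f => f ≫ w) (by
    rintro f g ⟨α, hα, rfl⟩
    exact ⟨α, hα, Category.assoc _ _ _⟩)

end

/-- A Borel `k`-coloring of a topological space `X`: all colour classes are Borel. -/
def IsBorelColoring {X : Type*} [TopologicalSpace X] {k : ℕ} (χ : X → Fin k) : Prop :=
  ∀ i, @MeasurableSet X (borel X) (χ ⁻¹' {i})

section

variable {C : Type*} [Category C] [TopEnriched C]

/-- The Borel partition arrow `D ⟶ (B)^A_{k, n}`: for every Borel `k`-coloring `χ` of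
`hom(A, D) / ∼` there is `w : B → D` such that `χ` takes at most `n` values on
`w · (hom(A, B) / ∼)`. -/
def BorelArrow (𝔊 : ∀ X : C, Subgroup (Aut X)) (D B A : C) (k n : ℕ) : Prop :=
  ∀ χ : SubObj 𝔊 A D → Fin k, IsBorelColoring χ →
    ∃ w : B ⟶ D, (χ '' Set.range (SubObj.postcomp (𝔊 := 𝔊) (A := A) w)).ncard ≤ n

/-- The big `𝔊`-Ramsey degree of `A` in `S`: the least positive integer `n` such that
`S ⟶ (S)^A_{k, n}` for all `k ≥ 2`, and `∞` if there is no such integer. -/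
noncomputable def bigRamseyDegree (𝔊 : ∀ X : C, Subgroup (Aut X)) (A S : C) : ℕ∞ :=
  sInf {t : ℕ∞ | ∃ n : ℕ, t = n ∧ 1 ≤ n ∧ ∀ k, 2 ≤ k → BorelArrow 𝔊 S S A k n}

/-- The big embedding Ramsey degree `T(A, S)`: the big Ramsey degree for the trivial groups
`{id}`, whose classes are the single morphisms. -/
noncomputable def bigEmbeddingRamseyDegree (A S : C) : ℕ∞ :=
  bigRamseyDegree (fun _ => ⊥) A S

end

end TopEnriched

/-! Given n + 1 distinct elements of `𝔊 A`, join two morphisms `A ⟶ S` when a quotient of two of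
these elements carries one to the other. Since morphisms are mono, no such quotient fixes a
morphism, so this is a loopless graph of bounded degree. Its edges are given by homeomorphisms, so
it has a finite proper Borel colouring (`exists_proper_borelColoring`). For every w the n + 1
translates of f ≫ w then have distinct colours, so n colours never suffice. -/

/-- Each point of a Hausdorff space has an open neighbourhood disjoint from its images under
finitely many continuous maps without fixed points. In the second countable case countably many
such sets cover the space. -/
theorem exists_countable_independent_open_cover {X ι : Type*} [TopologicalSpace X] [T2Space X]
    [SecondCountableTopology X] [Finite ι] (φ : ι → X → X) (hφ : ∀ i, Continuous (φ i))
    (hfree : ∀ i x, φ i x ≠ x) :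
    ∃ U : ℕ → Set X, (∀ N, IsOpen (U N)) ∧ (∀ x, ∃ N, x ∈ U N) ∧
      ∀ N i, ∀ x ∈ U N, φ i x ∉ U N := by
  have hnhds : ∀ x, ∃ V : Set X, IsOpen V ∧ x ∈ V ∧ ∀ i, ∀ y ∈ V, φ i y ∉ V := by
    intro x
    choose P Q hP hQ hxP hxQ hPQ using fun i => t2_separation (hfree i x)
    refine ⟨⋂ i, (Q i ∩ φ i ⁻¹' P i),
      isOpen_iInter_of_finite fun i => (hQ i).inter ((hP i).preimage (hφ i)),
      Set.mem_iInter.2 fun i => ⟨hxQ i, hxP i⟩, fun i y hy hy' => ?_⟩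
    exact Set.disjoint_left.1 (hPQ i) (Set.mem_iInter.1 hy i).2 (Set.mem_iInter.1 hy' i).1
  choose V hV hxV hind using hnhds
  obtain ⟨T, hT, hcover⟩ := TopologicalSpace.isOpen_iUnion_countable V hV
  rcases isEmpty_or_nonempty X with hX | ⟨⟨x₀⟩⟩
  · exact ⟨fun _ => ∅, fun _ => isOpen_empty, fun x => hX.elim x, fun _ _ x => hX.elim x⟩
  have hmem : ∀ x, ∃ t ∈ T, x ∈ V t := fun x => by
    have : x ∈ ⋃ t ∈ T, V t := hcover ▸ Set.mem_iUnion.2 ⟨x, hxV x⟩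
    simpa using this
  have hne : T.Nonempty := (hmem x₀).imp fun _ h => h.1
  obtain ⟨e, rfl⟩ := hT.exists_eq_range hne
  refine ⟨fun N => V (e N), fun N => hV _, fun x => ?_, fun N i => hind _ i⟩
  obtain ⟨_, ⟨N, rfl⟩, h⟩ := hmem x
  exact ⟨N, h⟩

/-- The greedy colouring along a rank function `r`: a point gets the least colour that none of
its neighbours of smaller rank has. -/
noncomputable def greedyColoring {X ι : Type*} (φ : ι → X → X) (r : X → ℕ) (x : X) : ℕ :=
  sInf {m | ∀ i, (h : r (φ i x) < r x) → greedyColoring φ r (φ i x) ≠ m}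
termination_by r x

section greedyColoring

variable {X ι : Type*} (φ : ι → X → X) (r : X → ℕ)

/-- Pigeonhole. The set in `greedyColoring` is therefore nonempty, and its `sInf` is a true minimum,
not the default 0. -/
theorem exists_le_card_forall_greedyColoring_ne [Fintype ι] (x : X) :
    ∃ m ≤ Fintype.card ι, ∀ i, r (φ i x) < r x → greedyColoring φ r (φ i x) ≠ m := by
  classical
  by_contra! h
  have hsub : Finset.range (Fintype.card ι + 1) ⊆
      Finset.univ.image fun i => greedyColoring φ r (φ i x) := fun m hm => by
    obtain ⟨i, -, hi⟩ := h m (Nat.lt_succ_iff.1 (Finset.mem_range.1 hm))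
    exact Finset.mem_image.2 ⟨i, Finset.mem_univ _, hi⟩
  have := (Finset.card_le_card hsub).trans Finset.card_image_le
  simp at this

theorem greedyColoring_le_card [Fintype ι] (x : X) :
    greedyColoring φ r x ≤ Fintype.card ι := by
  obtain ⟨m, hm, h⟩ := exists_le_card_forall_greedyColoring_ne φ r x
  rw [greedyColoring]
  exact (Nat.sInf_le (s := {m | ∀ i, (h : r (φ i x) < r x) → greedyColoring φ r (φ i x) ≠ m})
    h).trans hm

theorem greedyColoring_ne_of_lt [Fintype ι] {x : X} {i : ι} (h : r (φ i x) < r x) :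
    greedyColoring φ r (φ i x) ≠ greedyColoring φ r x := by
  obtain ⟨m, -, hm⟩ := exists_le_card_forall_greedyColoring_ne φ r x
  rw [greedyColoring.eq_1 φ r x]
  exact Nat.sInf_mem (s := {m | ∀ i, (h : r (φ i x) < r x) → greedyColoring φ r (φ i x) ≠ m})
    ⟨m, hm⟩ i h

/-- The right side only involves colours of points of smaller rank, as the induction for
measurability needs. -/
theorem greedyColoring_eq_iff [Fintype ι] (x : X) (m : ℕ) :
    greedyColoring φ r x = m ↔
      (∀ i, r (φ i x) < r x → greedyColoring φ r (φ i x) ≠ m) ∧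
        ∀ l < m, ∃ i, r (φ i x) < r x ∧ greedyColoring φ r (φ i x) = l := by
  constructor
  · rintro rfl
    refine ⟨fun i h => greedyColoring_ne_of_lt φ r h, fun l hl => ?_⟩
    by_contra! hno
    rw [greedyColoring] at hl
    exact Nat.notMem_of_lt_sInf hl hno
  · rintro ⟨h₁, h₂⟩
    rw [greedyColoring]
    refine le_antisymm (Nat.sInf_le h₁) (le_csInf ⟨m, h₁⟩ fun l hl => ?_)
    by_contra! hlt
    obtain ⟨i, hi, hil⟩ := h₂ l hlt
    exact hl i hi hil

theorem measurable_greedyColoring [Fintype ι] [MeasurableSpace X] (hφ : ∀ i, Measurable (φ i))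
    (hr : Measurable r) : Measurable (greedyColoring φ r) := by
  -- Strong induction on the rank: each slice is a countable Boolean combination of preimages of
  -- lower slices.
  have key : ∀ N m, MeasurableSet {x | r x = N ∧ greedyColoring φ r x = m} := by
    intro N
    induction N using Nat.strong_induction_on with
    | _ N ih =>
      have hnbr : ∀ i l, MeasurableSet {x | r (φ i x) < N ∧ greedyColoring φ r (φ i x) = l} := by
        intro i l
        have : {x | r (φ i x) < N ∧ greedyColoring φ r (φ i x) = l} =
            ⋃ M ∈ Set.Iio N, φ i ⁻¹' {y | r y = M ∧ greedyColoring φ r y = l} := by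
          ext x; simp
        rw [this]
        exact .biUnion (Set.to_countable _) fun M hM => hφ i (ih M hM l)
      intro m
      have : {x | r x = N ∧ greedyColoring φ r x = m} = r ⁻¹' {N} ∩
          ((⋂ i, {x | r (φ i x) < N ∧ greedyColoring φ r (φ i x) = m}ᶜ) ∩
            ⋂ l ∈ Set.Iio m, ⋃ i, {x | r (φ i x) < N ∧ greedyColoring φ r (φ i x) = l}) := by
        ext x
        simp only [Set.mem_ofPred_eq, Set.mem_inter_iff, Set.mem_preimage, Set.mem_singleton_iff,
          Set.mem_iInter, Set.mem_compl_iff, Set.mem_iUnion, Set.mem_Iio, not_and]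
        refine and_congr_right ?_
        rintro rfl
        exact greedyColoring_eq_iff φ r x m
      rw [this]
      exact (hr (measurableSet_singleton N)).inter
        ((MeasurableSet.iInter fun i => (hnbr i m).compl).inter
          (.biInter (Set.to_countable _) fun l _ => .iUnion fun i => hnbr i l))
  refine measurable_to_countable' fun m => ?_
  have : greedyColoring φ r ⁻¹' {m} = ⋃ N, {x | r x = N ∧ greedyColoring φ r x = m} := by
    ext x; simp
  rw [this]
  exact .iUnion fun N => key N m

end greedyColoring

/-- A graph of bounded degree given by finitely many continuous maps on a second countable
Hausdorff space has a proper Borel colouring with finitely many colours. -/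
theorem exists_proper_borelColoring {X ι : Type*} [TopologicalSpace X] [T2Space X]
    [SecondCountableTopology X] [Fintype ι] (φ : ι → X → X) (hφ : ∀ i, Continuous (φ i))
    (hfree : ∀ i x, φ i x ≠ x) (hsymm : ∀ i, ∃ j, ∀ x, φ j (φ i x) = x) {k : ℕ}
    (hk : Fintype.card ι < k) :
    ∃ χ : X → Fin k, TopEnriched.IsBorelColoring χ ∧ ∀ i x, χ (φ i x) ≠ χ x := by
  classical
  borelize X
  obtain ⟨U, hU, hcover, hind⟩ := exists_countable_independent_open_cover φ hφ hfree
  -- The rank is the first index of a cover set containing x; independence of these sets gives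
  -- neighbours different ranks.
  let r : X → ℕ := fun x => Nat.find (hcover x)
  have hr : Measurable r := measurable_find _ fun N => (hU N).measurableSet
  have hrne : ∀ i x, r (φ i x) ≠ r x := fun i x h =>
    hind (r x) i x (Nat.find_spec (hcover x)) (h ▸ Nat.find_spec (hcover (φ i x)))
  refine ⟨fun x => ⟨greedyColoring φ r x, (greedyColoring_le_card φ r x).trans_lt hk⟩,
    fun m => ?_, fun i x h => ?_⟩
  · rw [← BorelSpace.measurable_eq (α := X)]
    convert measurable_greedyColoring φ r (fun i => (hφ i).measurable) hr
      (measurableSet_singleton (m : ℕ)) using 1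
    ext x
    simp [Fin.ext_iff]
  · have h' : greedyColoring φ r (φ i x) = greedyColoring φ r x := congrArg Fin.val h
    rcases (hrne i x).lt_or_gt with hlt | hgt
    · exact greedyColoring_ne_of_lt φ r hlt h'
    · obtain ⟨j, hj⟩ := hsymm i
      have hlt : r (φ j (φ i x)) < r (φ i x) := by rwa [hj]
      exact greedyColoring_ne_of_lt φ r hlt (by rw [hj, h'])

/-! ### Colourings of hom-sets and the Ramsey degree -/

namespace TopEnriched

variable {C : Type*} [Category C] [TopEnriched C]

theorem continuous_precomp {A B : C} (α : A ⟶ A) : Continuous fun f : A ⟶ B => α ≫ f :=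
  (continuous_comp A A B).comp (continuous_id.prodMk continuous_const)

/-- A class modulo the trivial groups is a single morphism. -/
def SubObj.toHom {A B : C} : SubObj (fun X : C => (⊥ : Subgroup (Aut X))) A B → (A ⟶ B) :=
  Quotient.lift id (by
    rintro f g ⟨α, hα, rfl⟩
    obtain rfl := Subgroup.mem_bot.1 hα
    exact Category.id_comp g)

theorem SubObj.continuous_toHom {A B : C} : Continuous (SubObj.toHom (A := A) (B := B)) :=
  continuous_id.quotient_lift _

theorem IsBorelColoring.comp_continuous {X Y : Type*} [TopologicalSpace X] [TopologicalSpace Y]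
    {k : ℕ} {χ : Y → Fin k} (hχ : IsBorelColoring χ) {f : X → Y} (hf : Continuous f) :
    IsBorelColoring (χ ∘ f) := by
  borelize X Y
  intro i
  have := hχ i
  rw [← BorelSpace.measurable_eq (α := Y)] at this
  rw [← BorelSpace.measurable_eq (α := X)]
  exact hf.measurable this

/-- If all morphisms are mono, then for finitely many distinct automorphisms `α a`
there is a Borel colouring of `hom(A, S)` in which the morphisms `f · α a` have distinct colours,
for each `f`. -/
theorem exists_borelColoring_injective (hmono : ∀ {X Y : C} (f : X ⟶ Y), Mono f) {A S : C}
    [SecondCountableTopology (A ⟶ S)] [T2Space (A ⟶ S)] {κ : Type*} [Finite κ]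
    {α : κ → (A ≅ A)} (hα : Function.Injective α) :
    ∃ k, 2 ≤ k ∧ ∃ χ : (A ⟶ S) → Fin k, IsBorelColoring χ ∧
      ∀ f, Function.Injective fun a => χ ((α a).hom ≫ f) := by
  classical
  have := Fintype.ofFinite κ
  let φ : {p : κ × κ // p.1 ≠ p.2} → (A ⟶ S) → (A ⟶ S) :=
    fun p f => ((α p.1.2).hom ≫ (α p.1.1).inv) ≫ f
  obtain ⟨χ, hχ, hne⟩ := exists_proper_borelColoring φ (fun p => continuous_precomp _)
    (fun p f h => by
      have := hmono f
      have h1 : (α p.1.2).hom ≫ (α p.1.1).inv = 𝟙 A :=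
        (cancel_mono f).1 (h.trans (Category.id_comp f).symm)
      exact p.2 (hα (Iso.ext (by simpa using ((Iso.comp_inv_eq _).1 h1).symm))))
    (fun p => ⟨⟨p.1.swap, p.2.symm⟩, fun f => by simp [φ]⟩)
    -- Adding 2 rather than 1 also ensures at least two colours.
    (Nat.lt_add_of_pos_right (n := Fintype.card {p : κ × κ // p.1 ≠ p.2}) (k := 2) two_pos)
  refine ⟨_, Nat.le_add_left 2 _, χ, hχ, fun f a b hab => ?_⟩
  by_contra hne'
  -- The map for (a, b) sends the translate by α a to the translate by α b.
  refine hne ⟨(a, b), hne'⟩ ((α a).hom ≫ f) ?_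
  simpa [φ] using hab.symm

theorem enatCard_le_of_forall_borelArrow (hmono : ∀ {X Y : C} (f : X ⟶ Y), Mono f) {A S : C}
    [SecondCountableTopology (A ⟶ S)] [T2Space (A ⟶ S)] (G : Subgroup (Aut A)) (f : A ⟶ S)
    {n : ℕ} (hn : ∀ k, 2 ≤ k → BorelArrow (fun X : C => (⊥ : Subgroup (Aut X))) S S A k n) :
    ENat.card G ≤ n := by
  by_contra! hlt
  have hle : ((n + 1 : ℕ) : ℕ∞) ≤ (Set.univ : Set G).encard := by
    rw [Set.encard_univ]
    exact_mod_cast Order.add_one_le_of_lt hlt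
  obtain ⟨F, -, hF⟩ := Set.exists_subset_encard_eq hle
  have hfin : F.Finite := Set.finite_of_encard_eq_coe hF
  have := hfin.to_subtype
  obtain ⟨k, hk, χ, hχ, hinj⟩ := exists_borelColoring_injective (S := S) hmono
    (α := fun a : F => ((a : G) : Aut A)) (Subtype.val_injective.comp Subtype.val_injective)
  obtain ⟨w, hw⟩ := hn k hk _ (hχ.comp_continuous SubObj.continuous_toHom)
  have hsub : Set.range (fun a : F => χ (((a : G) : Aut A).hom ≫ f ≫ w)) ⊆
      (χ ∘ SubObj.toHom) '' Set.range
        (SubObj.postcomp (𝔊 := fun X : C => (⊥ : Subgroup (Aut X))) (A := A) w) := by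
    rintro _ ⟨a, rfl⟩
    refine ⟨_, ⟨Quotient.mk _ (((a : G) : Aut A).hom ≫ f), rfl⟩, ?_⟩
    exact congrArg χ (Category.assoc _ _ _)
  have hcard : (Set.range fun a : F => χ (((a : G) : Aut A).hom ≫ f ≫ w)).ncard = n + 1 := by
    rw [← Set.image_univ, Set.ncard_image_of_injective _ (hinj (f ≫ w)), Set.ncard_univ,
      Nat.card_coe_set_eq, Set.ncard, hF, ENat.toNat_natCast]
  have := (Set.ncard_le_ncard hsub (Set.toFinite _)).trans hw
  omega

end TopEnriched

theorem mainTheorem8 {C : Type*} [Category C] [TopEnriched C]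
    (hmono : ∀ {X Y : C} (f : X ⟶ Y), Mono f)
    (𝔊 : ∀ X : C, Subgroup (Aut X)) (A S : C)
    [LocallyCompactSpace (A ⟶ A)] [SecondCountableTopology (A ⟶ A)] [T2Space (A ⟶ A)]
    [LocallyCompactSpace (A ⟶ S)] [SecondCountableTopology (A ⟶ S)] [T2Space (A ⟶ S)]
    (hgroup : TopEnriched.IsTopologicalSubgroup (𝔊 A))
    (hclosed : TopEnriched.IsClosedInHom (𝔊 A))
    (hAS : Nonempty (A ⟶ S)) :
    ENat.card (𝔊 A) ≤ TopEnriched.bigEmbeddingRamseyDegree A S ∧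
      (Infinite (𝔊 A) → TopEnriched.bigEmbeddingRamseyDegree A S = ⊤) := by
  obtain ⟨f⟩ := hAS
  have hle : ENat.card (𝔊 A) ≤ TopEnriched.bigEmbeddingRamseyDegree A S := by
    -- If no n is admissible, the infimum is over the empty set and equals `⊤`.
    refine le_sInf ?_
    rintro _ ⟨n, rfl, -, hn⟩
    exact TopEnriched.enatCard_le_of_forall_borelArrow hmono (𝔊 A) f hn
  exact ⟨hle, fun _ => top_le_iff.1 (ENat.card_eq_top_of_infinite (α := 𝔊 A) ▸ hle)⟩
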